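/- Let $H_1$ and $H_2$ be (real or complex) Hilbert spaces. For a bounded linear map $A$ write $N(A)$ for its null space and $R(A)$ for its range. A pair $(S,T)$ of bounded linear maps $S\colon H_1\to H_2$, $T\colon H_2\to H_1$ is called a Fredholm pair if the dimensions $$a=\dim N(S)/(N(S)\cap R(T)),\quad b=\dim R(T)/(N(S)\cap R(T)),$$ $$c=\dim N(T)/(N(T)\cap R(S)),\quad d=\dim R(S)/(N(T)\cap R(S))$$ are all finite; its index is then $\operatorname{ind}(S,T)=a-b-c+d\in\mathbb{Z}$. Theorem. Let $(S,T)$ be a Fredholm pair, let $K\colon H_1\to H_2$ and $K'\colon H_2\to H_1$ be compact operators, and set $S_1=S+K$ and $T_1=T+K'$. Suppose that $R(T_1S_1)\subseteq H_1$ and $R(S_1T_1)\subseteq H_2$ are finite dimensional. Then $(S_1,T_1)$ is a Fredholm pair and $$\operatorname{ind}(S,T)=\operatorname{ind}(S_1,T_1).$$ -/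

import Mathlib

namespace FredholmPair

variable {𝕜 H₁ H₂ : Type*} [RCLike 𝕜]
  [NormedAddCommGroup H₁] [InnerProductSpace 𝕜 H₁]
  [NormedAddCommGroup H₂] [InnerProductSpace 𝕜 H₂]

/-- The null space `N(S)`. -/
abbrev nullSpace (S : H₁ →L[𝕜] H₂) : Submodule 𝕜 H₁ := LinearMap.ker (S : H₁ →ₗ[𝕜] H₂)

/-- The range `R(S)` (not closed up). -/
abbrev rangeSpace (S : H₁ →L[𝕜] H₂) : Submodule 𝕜 H₂ := LinearMap.range (S : H₁ →ₗ[𝕜] H₂)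

/-- The quotient space `N(S) / (N(S) ∩ R(T))`. -/
abbrev NullQuotient (S : H₁ →L[𝕜] H₂) (T : H₂ →L[𝕜] H₁) : Type _ :=
  nullSpace S ⧸ (nullSpace S ⊓ rangeSpace T).submoduleOf (nullSpace S)

/-- The quotient space `R(T) / (N(S) ∩ R(T))`. -/
abbrev RangeQuotient (S : H₁ →L[𝕜] H₂) (T : H₂ →L[𝕜] H₁) : Type _ :=
  rangeSpace T ⧸ (nullSpace S ⊓ rangeSpace T).submoduleOf (rangeSpace T)

/-- `(S, T)` is a Fredholm pair: the four quotients `N(S) / (N(S) ∩ R(T))`,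
`R(T) / (N(S) ∩ R(T))`, `N(T) / (N(T) ∩ R(S))`, `R(S) / (N(T) ∩ R(S))` are finite dimensional. -/
structure IsFredholmPair (S : H₁ →L[𝕜] H₂) (T : H₂ →L[𝕜] H₁) : Prop where
  finite_a : FiniteDimensional 𝕜 (NullQuotient S T)
  finite_b : FiniteDimensional 𝕜 (RangeQuotient S T)
  finite_c : FiniteDimensional 𝕜 (NullQuotient T S)
  finite_d : FiniteDimensional 𝕜 (RangeQuotient T S)

/-- The index `a - b - c + d` of a pair, an integer; meaningful for Fredholm pairs. -/
noncomputable def index (S : H₁ →L[𝕜] H₂) (T : H₂ →L[𝕜] H₁) : ℤ :=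
  (Module.finrank 𝕜 (NullQuotient S T) : ℤ) - (Module.finrank 𝕜 (RangeQuotient S T) : ℤ)
    - (Module.finrank 𝕜 (NullQuotient T S) : ℤ) + (Module.finrank 𝕜 (RangeQuotient T S) : ℤ)

end FredholmPair

/-! Call subspaces commensurable if each lies in the other up to finite dimension. A Fredholm pair
is one where `N(S)`, `R(T)` and `N(T)`, `R(S)` are commensurable, and its index is a sum of two
relative dimensions, which are additive along chains. If `S` changes only off a subspace of finite
codimension, rank-nullity makes the relative dimensions of old and new kernel and of old and new
range cancel (`relDim_ker_add_relDim_range`), so the index survives.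

In a Fredholm pair `ST` and `TS` have finite rank; for the perturbed pair this is assumed. Such
changes therefore make all products vanish (`exists_comp_eq_zero`). For a pair with `ST = 0` and `TS
= 0`, Hodge theory identifies the index with that of the single Fredholm operator `S + T†`
(`IsFredholmPair.add_adjoint`). The two operators so obtained differ by a norm limit of finite rank
operators, which does not affect the Fredholm index (`IsFredholmPair.add_isFiniteRankLimit`). -/

namespace Submodule

/-! ### Commensurable subspaces and relative dimension. -/

variable {K X Y Z : Type*} [Field K] [AddCommGroup X] [Module K X] [AddCommGroup Y] [Module K Y]
  [AddCommGroup Z] [Module K Z]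

theorem nonempty_map_equiv_quotient (g : X →ₗ[K] Z) {A : Submodule K X} {Q : Submodule K A}
    (h : ∀ x : A, x ∈ Q ↔ g x = 0) : Nonempty (A.map g ≃ₗ[K] A ⧸ Q) := by
  have hQ : Q = LinearMap.ker (g.domRestrict A) := by
    ext x
    rw [h x, LinearMap.mem_ker, LinearMap.domRestrict_apply]
  have hr : A.map g = LinearMap.range (g.domRestrict A) := by
    rw [LinearMap.range_domRestrict]
  subst hQ
  rw [hr]
  exact ⟨(g.domRestrict A).quotKerEquivRange.symm⟩

/-- `A.AlmostLE B` means that `A / (A ∩ B)` is finite dimensional. -/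
def AlmostLE (A B : Submodule K X) : Prop := FiniteDimensional K (A.map B.mkQ)

/-- The dimension of `A / (A ∩ B)`. -/
noncomputable def relCodim (A B : Submodule K X) : ℕ := Module.finrank K (A.map B.mkQ)

/-- The relative dimension of two commensurable subspaces. -/
noncomputable def relDim (A B : Submodule K X) : ℤ := relCodim A B - relCodim B A

theorem nonempty_map_mkQ_equiv_map (g : X →ₗ[K] Z) {A B : Submodule K X}
    (h : ∀ x ∈ A, x ∈ B ↔ g x = 0) : Nonempty (A.map B.mkQ ≃ₗ[K] A.map g) := by
  obtain ⟨e⟩ := nonempty_map_equiv_quotient (A := A) (Q := B.submoduleOf A) B.mkQ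
    (fun x => by simp [Submodule.submoduleOf])
  obtain ⟨e'⟩ := nonempty_map_equiv_quotient (A := A) (Q := B.submoduleOf A) g
    (fun x => by simpa [Submodule.submoduleOf] using h x x.2)
  exact ⟨e.trans e'.symm⟩

theorem almostLE_iff_map (g : X →ₗ[K] Z) {A B : Submodule K X}
    (h : ∀ x ∈ A, x ∈ B ↔ g x = 0) : AlmostLE A B ↔ FiniteDimensional K (A.map g) := by
  obtain ⟨e⟩ := nonempty_map_mkQ_equiv_map g h
  exact Module.Finite.equiv_iff e

theorem relCodim_eq_map (g : X →ₗ[K] Z) {A B : Submodule K X}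
    (h : ∀ x ∈ A, x ∈ B ↔ g x = 0) : relCodim A B = Module.finrank K (A.map g) := by
  obtain ⟨e⟩ := nonempty_map_mkQ_equiv_map g h
  exact e.finrank_eq

theorem nonempty_map_mkQ_equiv_quotient {A B : Submodule K X} {Q : Submodule K A}
    (h : ∀ x : A, x ∈ Q ↔ (x : X) ∈ B) : Nonempty (A.map B.mkQ ≃ₗ[K] A ⧸ Q) :=
  nonempty_map_equiv_quotient _ fun x => by simp [h x]

theorem almostLE_iff_exists {A B : Submodule K X} :
    AlmostLE A B ↔ ∃ V : Submodule K X, FiniteDimensional K V ∧ A ≤ B ⊔ V := by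
  constructor
  · intro h
    have h' : FiniteDimensional K (A.map B.mkQ) := h
    obtain ⟨g, hg⟩ := B.mkQ.exists_rightInverse_of_surjective B.range_mkQ
    refine ⟨(A.map B.mkQ).map g, inferInstance, ?_⟩
    rw [← Submodule.comap_map_mkQ, ← Submodule.map_comp, hg, Submodule.map_id]
    exact Submodule.le_comap_map _ _
  · rintro ⟨V, hV, h⟩
    have h1 : A.map B.mkQ ≤ V.map B.mkQ := by
      refine (Submodule.map_mono h).trans ?_
      simp [Submodule.map_sup]
    exact Submodule.finiteDimensional_of_le h1

theorem AlmostLE.of_le {A B : Submodule K X} (h : A ≤ B) : AlmostLE A B :=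
  almostLE_iff_exists.2 ⟨⊥, inferInstance, by simpa using h⟩

theorem AlmostLE.trans {A B C : Submodule K X} (h : AlmostLE A B) (h' : AlmostLE B C) :
    AlmostLE A C := by
  obtain ⟨V, hV, hA⟩ := almostLE_iff_exists.1 h
  obtain ⟨V', hV', hB⟩ := almostLE_iff_exists.1 h'
  refine almostLE_iff_exists.2 ⟨V' ⊔ V, inferInstance, hA.trans ?_⟩
  rw [← sup_assoc]
  exact sup_le_sup_right hB V

theorem AlmostLE.mono {A A' B B' : Submodule K X} (h : AlmostLE A B) (hA : A' ≤ A) (hB : B ≤ B') :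
    AlmostLE A' B' :=
  ((AlmostLE.of_le hA).trans h).trans (AlmostLE.of_le hB)

theorem AlmostLE.inf {A B C : Submodule K X} (h : AlmostLE A B) (h' : AlmostLE A C) :
    AlmostLE A (B ⊓ C) := by
  rw [almostLE_iff_map (B.mkQ.prod C.mkQ) (fun x _ => by simp)]
  have : A.map (B.mkQ.prod C.mkQ) ≤ (A.map B.mkQ).prod (A.map C.mkQ) := by
    rintro _ ⟨x, hx, rfl⟩
    exact ⟨⟨x, hx, rfl⟩, ⟨x, hx, rfl⟩⟩
  have h1 : FiniteDimensional K (A.map B.mkQ) := h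
  have h2 : FiniteDimensional K (A.map C.mkQ) := h'
  have h3 : FiniteDimensional K ((A.map B.mkQ).prod (A.map C.mkQ)) :=
    Module.Finite.iff_fg.mpr ((Module.Finite.iff_fg.mp h1).prod (Module.Finite.iff_fg.mp h2))
  exact Submodule.finiteDimensional_of_le this

theorem AlmostLE.map {A B : Submodule K X} (h : AlmostLE A B) (f : X →ₗ[K] Y) :
    AlmostLE (A.map f) (B.map f) := by
  obtain ⟨V, hV, hA⟩ := almostLE_iff_exists.1 h
  exact almostLE_iff_exists.2 ⟨V.map f, inferInstance, by
    rw [← Submodule.map_sup]; exact Submodule.map_mono hA⟩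

theorem AlmostLE.comap {B : Submodule K Y} (h : AlmostLE ⊤ B) (f : X →ₗ[K] Y) :
    AlmostLE ⊤ (B.comap f) := by
  rw [almostLE_iff_map (B.mkQ ∘ₗ f) (fun x _ => by simp)]
  rw [AlmostLE] at h
  rw [Submodule.map_comp]
  exact Submodule.finiteDimensional_of_le (Submodule.map_mono le_top)

theorem almostLE_ker_iff (f : X →ₗ[K] Y) :
    AlmostLE ⊤ (LinearMap.ker f) ↔ FiniteDimensional K (LinearMap.range f) := by
  rw [almostLE_iff_map f (fun x _ => by simp), Submodule.map_top]

theorem almostLE_bot_iff {A : Submodule K X} : AlmostLE A ⊥ ↔ FiniteDimensional K A := by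
  rw [almostLE_iff_map LinearMap.id (fun x _ => by simp), Submodule.map_id]

theorem relCodim_bot {A : Submodule K X} : relCodim A ⊥ = Module.finrank K A := by
  rw [relCodim_eq_map LinearMap.id (fun x _ => by simp), Submodule.map_id]

theorem relCodim_congr {A B B' : Submodule K X} (h : A ⊓ B = A ⊓ B') :
    relCodim A B = relCodim A B' :=
  relCodim_eq_map _ fun x hx => by
    have := SetLike.ext_iff.1 h x
    simpa [hx] using this

theorem relCodim_inf_left {A B : Submodule K X} : relCodim A (A ⊓ B) = relCodim A B :=
  relCodim_congr (by simp)

theorem relCodim_sup_right {A B : Submodule K X} : relCodim (A ⊔ B) B = relCodim A B := by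
  have h : (A ⊔ B).map B.mkQ = A.map B.mkQ := by simp [Submodule.map_sup]
  rw [relCodim, h, relCodim]

theorem relCodim_of_le {A B : Submodule K X} (h : A ≤ B) : relCodim A B = 0 := by
  have h' : A.map B.mkQ = ⊥ := by
    rwa [← le_bot_iff, Submodule.map_le_iff_le_comap, Submodule.comap_bot, Submodule.ker_mkQ]
  rw [relCodim, h']
  exact finrank_bot K _

/-- Rank-nullity for `X / C → X / B` restricted to the image of `A`; the kernel there is the image
of `B`. -/
theorem relCodim_tower {A B C : Submodule K X} (hCB : C ≤ B) (hBA : B ≤ A) (h : AlmostLE A C) :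
    relCodim A C = relCodim A B + relCodim B C := by
  have hfin : FiniteDimensional K (A.map C.mkQ) := h
  let f : (X ⧸ C) →ₗ[K] (X ⧸ B) := Submodule.factor hCB
  have key := LinearMap.finrank_range_add_finrank_ker (f.domRestrict (A.map C.mkQ))
  have h1 : LinearMap.range (f.domRestrict (A.map C.mkQ)) = A.map B.mkQ := by
    rw [LinearMap.range_domRestrict, ← Submodule.map_comp]
    rfl
  have h2 : (LinearMap.ker (f.domRestrict (A.map C.mkQ))).map (A.map C.mkQ).subtype
      = B.map C.mkQ := by
    ext y
    constructor
    · rintro ⟨⟨_, ⟨x, hx, rfl⟩⟩, hy, rfl⟩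
      refine ⟨x, ?_, rfl⟩
      simpa [f] using hy
    · rintro ⟨x, hx, rfl⟩
      refine ⟨⟨C.mkQ x, ⟨x, hBA hx, rfl⟩⟩, ?_, rfl⟩
      simpa [f] using hx
  have h3 : Module.finrank K (LinearMap.ker (f.domRestrict (A.map C.mkQ)))
      = Module.finrank K (B.map C.mkQ) := by
    rw [← h2]
    exact (Submodule.equivMapOfInjective _ (Submodule.injective_subtype _) _).finrank_eq
  rw [h1, h3] at key
  exact key.symm

/-- Frees the relative dimension from `A ⊓ B`: any common subspace of finite codimension serves, so
several subspaces can be measured against one `W`. -/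
theorem relDim_eq_of_le {A B W : Submodule K X} (hA : W ≤ A) (hB : W ≤ B) (hA' : AlmostLE A W)
    (hB' : AlmostLE B W) : relDim A B = relCodim A W - relCodim B W := by
  have h1 := relCodim_tower (le_inf hA hB) (inf_le_left : A ⊓ B ≤ A) hA'
  have h2 := relCodim_tower (le_inf hA hB) (inf_le_right : A ⊓ B ≤ B) hB'
  rw [relCodim_inf_left] at h1
  rw [relCodim_congr (A := B) (B := A ⊓ B) (B' := A) (by rw [inf_comm A B]; simp)] at h2
  rw [relDim, h1, h2]
  push_cast
  ring

theorem relDim_add {A B C : Submodule K X} (hAB : AlmostLE A B) (hBA : AlmostLE B A)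
    (hBC : AlmostLE B C) (hCB : AlmostLE C B) : relDim A B + relDim B C = relDim A C := by
  have hA : A ⊓ B ⊓ C ≤ A := inf_le_left.trans inf_le_left
  have hB : A ⊓ B ⊓ C ≤ B := inf_le_left.trans inf_le_right
  have hC : A ⊓ B ⊓ C ≤ C := inf_le_right
  have fA : AlmostLE A (A ⊓ B ⊓ C) := ((AlmostLE.of_le le_rfl).inf hAB).inf (hAB.trans hBC)
  have fB : AlmostLE B (A ⊓ B ⊓ C) := (hBA.inf (AlmostLE.of_le le_rfl)).inf hBC
  have fC : AlmostLE C (A ⊓ B ⊓ C) := ((hCB.trans hBA).inf hCB).inf (AlmostLE.of_le le_rfl)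
  rw [relDim_eq_of_le hA hB fA fB, relDim_eq_of_le hB hC fB fC, relDim_eq_of_le hA hC fA fC]
  ring

/-! ### Linear maps that agree on a subspace of finite codimension. -/

/-- Insert `ker f ⊔ W` between `W` and `⊤`: the upper step is carried by `f` to `range f / f(W)`,
the lower one is `ker f / (ker f ⊓ W)`. -/
theorem relCodim_top_eq_add (f : X →ₗ[K] Y) {W : Submodule K X} (hW : AlmostLE ⊤ W) :
    relCodim ⊤ W = relCodim (LinearMap.range f) (W.map f) + relCodim (LinearMap.ker f) W := by
  rw [relCodim_tower (B := LinearMap.ker f ⊔ W) le_sup_right le_top hW, relCodim_sup_right]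
  congr 1
  rw [relCodim_eq_map ((W.map f).mkQ ∘ₗ f) (fun x _ => ?_), Submodule.map_comp, Submodule.map_top]
  · rfl
  · rw [sup_comm, ← Submodule.comap_map_eq]
    simp

theorem almostLE_ker_of_eqOn {S S' : X →ₗ[K] Y} {W : Submodule K X} (hW : AlmostLE ⊤ W)
    (h : ∀ x ∈ W, S x = S' x) : AlmostLE (LinearMap.ker S) (LinearMap.ker S') := by
  refine (((AlmostLE.of_le le_rfl).inf (hW.mono le_top le_rfl)).trans
    (B := LinearMap.ker S ⊓ W) (AlmostLE.of_le ?_))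
  rintro x ⟨hx, hxW⟩
  rw [LinearMap.mem_ker, ← h x hxW]
  exact hx

theorem almostLE_range_of_eqOn {S S' : X →ₗ[K] Y} {W : Submodule K X} (hW : AlmostLE ⊤ W)
    (h : ∀ x ∈ W, S x = S' x) : AlmostLE (LinearMap.range S) (LinearMap.range S') := by
  have h1 := hW.map S
  rw [Submodule.map_top] at h1
  refine h1.mono le_rfl ?_
  rintro _ ⟨x, hx, rfl⟩
  exact ⟨x, (h x hx).symm⟩

/-- `S` and `S'` have the same image of `W` and the same kernel on `W`; subtract the two instances
of `relCodim_top_eq_add`, both computing the codimension of `W`. -/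
theorem relDim_ker_add_relDim_range {S S' : X →ₗ[K] Y} {W : Submodule K X} (hW : AlmostLE ⊤ W)
    (h : ∀ x ∈ W, S x = S' x) :
    relDim (LinearMap.ker S) (LinearMap.ker S')
      + relDim (LinearMap.range S) (LinearMap.range S') = 0 := by
  have hmap : W.map S = W.map S' := by
    ext y
    constructor
    · rintro ⟨x, hx, rfl⟩
      exact ⟨x, hx, (h x hx).symm⟩
    · rintro ⟨x, hx, rfl⟩
      exact ⟨x, hx, h x hx⟩
  have hker : LinearMap.ker S ⊓ W = LinearMap.ker S' ⊓ W := by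
    ext x
    simp only [Submodule.mem_inf, LinearMap.mem_ker, and_congr_left_iff]
    intro hx
    rw [h x hx]
  have hWk : ∀ A : Submodule K X, AlmostLE A W := fun A => hW.mono le_top le_rfl
  have e1 := relDim_eq_of_le (A := LinearMap.ker S) (B := LinearMap.ker S')
    (W := LinearMap.ker S ⊓ W) inf_le_left (hker ▸ inf_le_left)
    ((AlmostLE.of_le le_rfl).inf (hWk _)) (hker ▸ (AlmostLE.of_le le_rfl).inf (hWk _))
  have e2 := relDim_eq_of_le (A := LinearMap.range S) (B := LinearMap.range S')
    (W := W.map S) LinearMap.map_le_range (hmap ▸ LinearMap.map_le_range)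
    (by simpa using hW.map S) (by rw [hmap]; simpa using hW.map S')
  have e3 := relCodim_top_eq_add S hW
  have e4 := relCodim_top_eq_add S' hW
  rw [relCodim_inf_left] at e1
  rw [hker, relCodim_inf_left] at e1
  rw [e1, e2]
  rw [← hmap] at e4
  omega

end Submodule

namespace FredholmPair

open Submodule

variable {𝕜 H₁ H₂ : Type*} [RCLike 𝕜]
  [NormedAddCommGroup H₁] [InnerProductSpace 𝕜 H₁]
  [NormedAddCommGroup H₂] [InnerProductSpace 𝕜 H₂]

/-! ### Fredholm pairs in terms of commensurability. -/

theorem nonempty_nullQuotient_equiv (S : H₁ →L[𝕜] H₂) (T : H₂ →L[𝕜] H₁) :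
    Nonempty ((nullSpace S).map (rangeSpace T).mkQ ≃ₗ[𝕜] NullQuotient S T) :=
  nonempty_map_mkQ_equiv_quotient fun x => by simp [submoduleOf]

theorem nonempty_rangeQuotient_equiv (S : H₁ →L[𝕜] H₂) (T : H₂ →L[𝕜] H₁) :
    Nonempty ((rangeSpace T).map (nullSpace S).mkQ ≃ₗ[𝕜] RangeQuotient S T) :=
  nonempty_map_mkQ_equiv_quotient fun x => by simp [submoduleOf]

theorem isFredholmPair_iff {S : H₁ →L[𝕜] H₂} {T : H₂ →L[𝕜] H₁} :
    IsFredholmPair S T ↔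
      (AlmostLE (nullSpace S) (rangeSpace T) ∧ AlmostLE (rangeSpace T) (nullSpace S)) ∧
      (AlmostLE (nullSpace T) (rangeSpace S) ∧ AlmostLE (rangeSpace S) (nullSpace T)) := by
  obtain ⟨e₁⟩ := nonempty_nullQuotient_equiv S T
  obtain ⟨e₂⟩ := nonempty_rangeQuotient_equiv S T
  obtain ⟨e₃⟩ := nonempty_nullQuotient_equiv T S
  obtain ⟨e₄⟩ := nonempty_rangeQuotient_equiv T S
  simp only [AlmostLE, FiniteDimensional]
  rw [Module.Finite.equiv_iff e₁, Module.Finite.equiv_iff e₂, Module.Finite.equiv_iff e₃,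
    Module.Finite.equiv_iff e₄]
  exact ⟨fun h => ⟨⟨h.1, h.2⟩, ⟨h.3, h.4⟩⟩, fun h => ⟨h.1.1, h.1.2, h.2.1, h.2.2⟩⟩

theorem finrank_nullQuotient (S : H₁ →L[𝕜] H₂) (T : H₂ →L[𝕜] H₁) :
    Module.finrank 𝕜 (NullQuotient S T) = relCodim (nullSpace S) (rangeSpace T) := by
  obtain ⟨e⟩ := nonempty_nullQuotient_equiv S T
  exact e.finrank_eq.symm

theorem finrank_rangeQuotient (S : H₁ →L[𝕜] H₂) (T : H₂ →L[𝕜] H₁) :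
    Module.finrank 𝕜 (RangeQuotient S T) = relCodim (rangeSpace T) (nullSpace S) := by
  obtain ⟨e⟩ := nonempty_rangeQuotient_equiv S T
  exact e.finrank_eq.symm

theorem index_eq_relDim (S : H₁ →L[𝕜] H₂) (T : H₂ →L[𝕜] H₁) :
    index S T = relDim (nullSpace S) (rangeSpace T) + relDim (rangeSpace S) (nullSpace T) := by
  rw [index, finrank_nullQuotient, finrank_nullQuotient, finrank_rangeQuotient,
    finrank_rangeQuotient, relDim, relDim]
  ring

theorem IsFredholmPair.symm {S : H₁ →L[𝕜] H₂} {T : H₂ →L[𝕜] H₁} (h : IsFredholmPair S T) :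
    IsFredholmPair T S :=
  ⟨h.3, h.4, h.1, h.2⟩

theorem index_swap (S : H₁ →L[𝕜] H₂) (T : H₂ →L[𝕜] H₁) : index T S = - index S T := by
  simp only [index]
  ring

/-- Changing `S` off a subspace of finite codimension preserves Fredholm pairs and their index. -/
theorem IsFredholmPair.congr_left {S S' : H₁ →L[𝕜] H₂} {T : H₂ →L[𝕜] H₁}
    (h : IsFredholmPair S T) {W : Submodule 𝕜 H₁} (hW : AlmostLE ⊤ W)
    (hSS' : ∀ x ∈ W, S x = S' x) : IsFredholmPair S' T ∧ index S T = index S' T := by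
  obtain ⟨⟨h1, h2⟩, h3, h4⟩ := isFredholmPair_iff.1 h
  have hS'S : ∀ x ∈ W, S' x = S x := fun x hx => (hSS' x hx).symm
  have k1 : AlmostLE (nullSpace S) (nullSpace S') := almostLE_ker_of_eqOn hW hSS'
  have k2 : AlmostLE (nullSpace S') (nullSpace S) := almostLE_ker_of_eqOn hW hS'S
  have r1 : AlmostLE (rangeSpace S) (rangeSpace S') := almostLE_range_of_eqOn hW hSS'
  have r2 : AlmostLE (rangeSpace S') (rangeSpace S) := almostLE_range_of_eqOn hW hS'S
  refine ⟨isFredholmPair_iff.2 ⟨⟨k2.trans h1, h2.trans k1⟩, h3.trans r1, r2.trans h4⟩, ?_⟩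
  have e1 := relDim_add k1 k2 (k2.trans h1) (h2.trans k1)
  have e2 := relDim_add r1 r2 (r2.trans h4) (h3.trans r1)
  have e3 : relDim (nullSpace S) (nullSpace S') + relDim (rangeSpace S) (rangeSpace S') = 0 :=
    relDim_ker_add_relDim_range hW hSS'
  rw [index_eq_relDim, index_eq_relDim]
  linarith

theorem IsFredholmPair.congr_right {S : H₁ →L[𝕜] H₂} {T T' : H₂ →L[𝕜] H₁}
    (h : IsFredholmPair S T) {W : Submodule 𝕜 H₂} (hW : AlmostLE ⊤ W)
    (hTT' : ∀ x ∈ W, T x = T' x) : IsFredholmPair S T' ∧ index S T = index S T' := by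
  obtain ⟨h1, h2⟩ := h.symm.congr_left hW hTT'
  refine ⟨h1.symm, ?_⟩
  rw [index_swap T S, index_swap T' S, h2]

/-! ### Fredholm operators as pairs `(D, 0)`, and small perturbations. -/

theorem isFredholmPair_zero_iff {D : H₁ →L[𝕜] H₂} :
    IsFredholmPair D 0 ↔ FiniteDimensional 𝕜 (nullSpace D) ∧ AlmostLE ⊤ (rangeSpace D) := by
  have h1 : rangeSpace (0 : H₂ →L[𝕜] H₁) = ⊥ := by simp [rangeSpace]
  have h2 : nullSpace (0 : H₂ →L[𝕜] H₁) = ⊤ := by simp [nullSpace]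
  rw [isFredholmPair_iff, h1, h2, almostLE_bot_iff]
  exact ⟨fun h => ⟨h.1.1, h.2.1⟩,
    fun h => ⟨⟨h.1, AlmostLE.of_le bot_le⟩, h.2, AlmostLE.of_le le_top⟩⟩

theorem index_zero (D : H₁ →L[𝕜] H₂) :
    index D 0 = Module.finrank 𝕜 (nullSpace D) - relCodim ⊤ (rangeSpace D) := by
  have h1 : rangeSpace (0 : H₂ →L[𝕜] H₁) = ⊥ := by simp [rangeSpace]
  have h2 : nullSpace (0 : H₂ →L[𝕜] H₁) = ⊤ := by simp [nullSpace]
  rw [index_eq_relDim, h1, h2, relDim, relDim, relCodim_bot, relCodim_of_le bot_le,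
    relCodim_of_le le_top]
  simp
  ring

/-- If `A` restricted to a subspace `M` of finite codimension is injective and its range has a
finite dimensional complement `V`, then `A` is Fredholm of index `codim M - dim V`. -/
theorem isFredholmPair_zero_of_isCompl {A : H₁ →L[𝕜] H₂} {M : Submodule 𝕜 H₁}
    {V : Submodule 𝕜 H₂} (hM : AlmostLE ⊤ M) [FiniteDimensional 𝕜 V]
    (hinj : nullSpace A ⊓ M = ⊥) (hV : IsCompl (M.map (A : H₁ →ₗ[𝕜] H₂)) V) :
    IsFredholmPair A 0 ∧ index A 0 = relCodim ⊤ M - Module.finrank 𝕜 V := by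
  have hle : M.map (A : H₁ →ₗ[𝕜] H₂) ≤ rangeSpace A := LinearMap.map_le_range
  have hcof : AlmostLE ⊤ (M.map (A : H₁ →ₗ[𝕜] H₂)) :=
    almostLE_iff_exists.2 ⟨V, inferInstance, hV.sup_eq_top.ge⟩
  constructor
  · refine isFredholmPair_zero_iff.2 ⟨?_, hcof.mono le_rfl hle⟩
    rw [← almostLE_bot_iff, ← hinj]
    exact (AlmostLE.of_le le_rfl).inf (hM.mono le_top le_rfl)
  · have e1 : relCodim ⊤ M = relCodim (rangeSpace A) (M.map (A : H₁ →ₗ[𝕜] H₂))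
        + relCodim (nullSpace A) M := relCodim_top_eq_add (A : H₁ →ₗ[𝕜] H₂) hM
    have e2 : relCodim (nullSpace A) M = Module.finrank 𝕜 (nullSpace A) := by
      rw [← relCodim_inf_left, hinj, relCodim_bot]
    have e3 := relCodim_tower hle le_top hcof
    have e4 : relCodim ⊤ (M.map (A : H₁ →ₗ[𝕜] H₂)) = Module.finrank 𝕜 V := by
      rw [← hV.sup_eq_top, sup_comm, relCodim_sup_right, ← relCodim_bot]
      exact relCodim_congr (by rw [inf_bot_eq, inf_comm, hV.inf_eq_bot])
    rw [index_zero]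
    rw [e4] at e3
    rw [e2] at e1
    omega

theorem almostLE_top_orthogonal (N : Submodule 𝕜 H₁) [FiniteDimensional 𝕜 N] :
    AlmostLE ⊤ Nᗮ :=
  almostLE_iff_exists.2 ⟨N, inferInstance, by
    rw [sup_comm, Submodule.sup_orthogonal_of_hasOrthogonalProjection]⟩

/-- The Fredholm property and the index are stable under small perturbations. -/
theorem IsFredholmPair.exists_pos_forall_norm_sub_lt [CompleteSpace H₁] [CompleteSpace H₂]
    {D : H₁ →L[𝕜] H₂} (hD : IsFredholmPair D 0) :
    ∃ ε > 0, ∀ A : H₁ →L[𝕜] H₂, ‖A - D‖ < ε → IsFredholmPair A 0 ∧ index D 0 = index A 0 := by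
  obtain ⟨hN, hR⟩ := isFredholmPair_zero_iff.1 hD
  obtain ⟨V, hV⟩ := Submodule.exists_isCompl (rangeSpace D)
  have hVfin : FiniteDimensional 𝕜 V := by
    rw [← almostLE_bot_iff, ← hV.inf_eq_bot]
    exact (hR.mono le_top le_rfl).inf (AlmostLE.of_le le_rfl)
  let M := (nullSpace D)ᗮ
  have hM : AlmostLE ⊤ M := almostLE_top_orthogonal _
  -- `Φ D` is bijective. Whenever `Φ A` is, `A` is injective on `M` and `V` complements `A(M)`, so
  -- the index of `A` depends on `M` and `V` only. Invertibility is an open condition.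
  let Φ : (H₁ →L[𝕜] H₂) → (M × V) →L[𝕜] H₂ := fun A => (A ∘L M.subtypeL).coprod V.subtypeL
  have hΦ : ∀ A x v, Φ A (x, v) = A (x : H₁) + v := fun A x v => by simp [Φ]
  have hker : LinearMap.ker (Φ D : M × V →ₗ[𝕜] H₂) = ⊥ := by
    rw [LinearMap.ker_eq_bot']
    rintro ⟨x, v⟩ hxv
    have hxv' : D (x : H₁) + v = 0 := by rw [← hΦ]; exact hxv
    have hDx : D (x : H₁) ∈ V := by
      rw [eq_neg_of_add_eq_zero_left hxv']
      exact V.neg_mem v.2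
    have hDx0 : D (x : H₁) = 0 := (Submodule.mem_bot 𝕜).1
      (hV.inf_eq_bot ▸ (⟨⟨x, rfl⟩, hDx⟩ : D (x : H₁) ∈ rangeSpace D ⊓ V))
    have hx0 : (x : H₁) = 0 := (Submodule.mem_bot 𝕜).1
      ((nullSpace D).inf_orthogonal_eq_bot ▸ (⟨hDx0, x.2⟩ : (x : H₁) ∈ nullSpace D ⊓ M))
    rw [hDx0, zero_add] at hxv'
    ext
    · exact hx0
    · exact hxv'
  have hrange : LinearMap.range (Φ D : M × V →ₗ[𝕜] H₂) = ⊤ := by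
    rw [eq_top_iff]
    intro y _
    obtain ⟨_, ⟨x, rfl⟩, v, hv, rfl⟩ := Submodule.mem_sup.1 (hV.sup_eq_top.ge (mem_top (x := y)))
    have hx : x ∈ nullSpace D ⊔ M := by
      rw [Submodule.sup_orthogonal_of_hasOrthogonalProjection]; trivial
    obtain ⟨n, hn, m, hm, rfl⟩ := Submodule.mem_sup.1 hx
    have hn' : D n = 0 := hn
    refine ⟨(⟨m, hm⟩, ⟨v, hv⟩), ?_⟩
    change Φ D _ = _
    rw [hΦ]
    simp [hn']
  let e := ContinuousLinearEquiv.ofBijective (Φ D) hker hrange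
  have he : (e : (M × V) →L[𝕜] H₂) = Φ D := ContinuousLinearEquiv.coe_ofBijective _ _ _
  have hopen := ContinuousLinearEquiv.nhds e
  rw [he, Metric.mem_nhds_iff] at hopen
  obtain ⟨ε, hε, hball⟩ := hopen
  have hnear : ∀ A : H₁ →L[𝕜] H₂, ‖A - D‖ < ε →
      IsFredholmPair A 0 ∧ index A 0 = relCodim ⊤ M - Module.finrank 𝕜 V := by
    intro A hA
    -- `Φ A - Φ D` is `A - D` after the first projection, which has norm at most one; hence the same
    -- `ε` works.
    have hdist : Φ A ∈ Metric.ball (Φ D) ε := by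
      rw [Metric.mem_ball, dist_eq_norm]
      refine lt_of_le_of_lt ?_ hA
      refine ContinuousLinearMap.opNorm_le_bound _ (norm_nonneg _) ?_
      rintro ⟨x, v⟩
      have hsub : (Φ A - Φ D) (x, v) = (A - D) (x : H₁) := by
        simp [hΦ]
      rw [hsub]
      refine ((A - D).le_opNorm _).trans ?_
      gcongr
      exact norm_fst_le (x, v)
    obtain ⟨e', he'⟩ := hball hdist
    have he'' : ∀ x v, e' (x, v) = A (x : H₁) + v := fun x v => by
      rw [← hΦ, ← he']; rfl
    refine isFredholmPair_zero_of_isCompl hM ?_ (IsCompl.of_eq ?_ ?_)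
    · rw [eq_bot_iff]
      rintro x ⟨hx, hxM⟩
      have hx' : A x = 0 := hx
      have h0 : e' (⟨x, hxM⟩, 0) = 0 := by rw [he'']; simp [hx']
      have := (map_eq_zero_iff e' e'.injective).1 h0
      have h1 := congrArg (fun p => (p.1 : H₁)) this
      simpa using h1
    · rw [eq_bot_iff]
      rintro _ ⟨⟨x, hx, rfl⟩, hxV⟩
      have h0 : e' (⟨x, hx⟩, -⟨_, hxV⟩) = 0 := by rw [he'']; simp
      have := (map_eq_zero_iff e' e'.injective).1 h0
      have h1 := congrArg (fun p => (p.2 : H₂)) this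
      simpa using h1
    · rw [eq_top_iff]
      intro y _
      obtain ⟨⟨x, v⟩, rfl⟩ := e'.surjective y
      rw [he'']
      exact Submodule.add_mem_sup ⟨x, x.2, rfl⟩ v.2
  refine ⟨ε, hε, fun A hA => ⟨(hnear A hA).1, ?_⟩⟩
  rw [(hnear A hA).2, (hnear D (by simpa using hε)).2]

/-! ### Limits of finite rank operators and compact perturbations. -/

/-- `K` is a norm limit of finite rank operators. -/
def IsFiniteRankLimit (K : H₁ →L[𝕜] H₂) : Prop :=
  ∀ ε > 0, ∃ F : H₁ →L[𝕜] H₂, FiniteDimensional 𝕜 (rangeSpace F) ∧ ‖K - F‖ < ε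

theorem IsFiniteRankLimit.of_finiteDimensional_range {F : H₁ →L[𝕜] H₂}
    (h : FiniteDimensional 𝕜 (rangeSpace F)) : IsFiniteRankLimit F :=
  fun ε hε => ⟨F, h, by simpa using hε⟩

theorem IsFiniteRankLimit.add {K L : H₁ →L[𝕜] H₂} (hK : IsFiniteRankLimit K)
    (hL : IsFiniteRankLimit L) : IsFiniteRankLimit (K + L) := by
  intro ε hε
  obtain ⟨F, hF, hKF⟩ := hK (ε / 2) (by positivity)
  obtain ⟨G, hG, hLG⟩ := hL (ε / 2) (by positivity)
  refine ⟨F + G, ?_, ?_⟩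
  · have : rangeSpace (F + G) ≤ rangeSpace F ⊔ rangeSpace G := by
      rintro _ ⟨x, rfl⟩
      exact Submodule.add_mem_sup ⟨x, rfl⟩ ⟨x, rfl⟩
    exact Submodule.finiteDimensional_of_le this
  · rw [add_sub_add_comm]
    linarith [norm_add_le (K - F) (L - G)]

/-- `F†` vanishes on `R(F)ᗮ`, so its range is already the image of `R(F)`. -/
theorem finiteDimensional_range_adjoint [CompleteSpace H₁] [CompleteSpace H₂] {F : H₁ →L[𝕜] H₂}
    (h : FiniteDimensional 𝕜 (rangeSpace F)) :
    FiniteDimensional 𝕜 (rangeSpace (ContinuousLinearMap.adjoint F)) := by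
  have hle : rangeSpace (ContinuousLinearMap.adjoint F) ≤
      (rangeSpace F).map (ContinuousLinearMap.adjoint F : H₂ →ₗ[𝕜] H₁) := by
    rintro _ ⟨y, rfl⟩
    have hy : y ∈ rangeSpace F ⊔ (rangeSpace F)ᗮ := by
      rw [Submodule.sup_orthogonal_of_hasOrthogonalProjection]; trivial
    obtain ⟨u, hu, v, hv, rfl⟩ := Submodule.mem_sup.1 hy
    refine ⟨u, hu, ?_⟩
    have hv' : ContinuousLinearMap.adjoint F v = 0 := by
      refine ext_inner_right 𝕜 fun x => ?_
      rw [ContinuousLinearMap.adjoint_inner_left, inner_zero_left]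
      exact Submodule.inner_left_of_mem_orthogonal (⟨x, rfl⟩ : F x ∈ rangeSpace F) hv
    simp [hv']
  exact Submodule.finiteDimensional_of_le hle

theorem IsFiniteRankLimit.adjoint [CompleteSpace H₁] [CompleteSpace H₂] {K : H₁ →L[𝕜] H₂}
    (hK : IsFiniteRankLimit K) : IsFiniteRankLimit (ContinuousLinearMap.adjoint K) := by
  intro ε hε
  obtain ⟨F, hF, hKF⟩ := hK ε hε
  refine ⟨ContinuousLinearMap.adjoint F, finiteDimensional_range_adjoint hF, ?_⟩
  rwa [← map_sub, LinearIsometryEquiv.norm_map]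

/-- Cover the image of the unit ball by finitely many `ε / 2`-balls and project onto the span of
their centres: the projection is at least as close as the nearest centre. -/
theorem isFiniteRankLimit_of_isCompactOperator {K : H₁ →L[𝕜] H₂}
    (hK : IsCompactOperator K) : IsFiniteRankLimit K := by
  intro ε hε
  have hcomp : TotallyBounded (K '' Metric.closedBall 0 1) :=
    (hK.isCompact_closure_image_closedBall 1).totallyBounded.subset subset_closure
  obtain ⟨t, ht, hcover⟩ := Metric.totallyBounded_iff.1 hcomp (ε / 2) (by positivity)
  let V := Submodule.span 𝕜 t
  have hVfin : FiniteDimensional 𝕜 V := FiniteDimensional.span_of_finite 𝕜 ht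
  refine ⟨V.starProjection ∘L K, ?_, ?_⟩
  · have : rangeSpace (V.starProjection ∘L K) ≤ V := by
      rintro _ ⟨x, rfl⟩
      exact V.starProjection_apply_mem (K x)
    exact Submodule.finiteDimensional_of_le this
  · refine lt_of_le_of_lt
      (ContinuousLinearMap.opNorm_le_of_unit_norm (C := ε / 2) (by positivity) ?_)
      (half_lt_self hε)
    intro x hx
    have hx' : K x ∈ K '' Metric.closedBall 0 1 := ⟨x, by simp [hx], rfl⟩
    obtain ⟨y, hy, hxy⟩ := Set.mem_iUnion₂.1 (hcover hx')
    rw [Metric.mem_ball, dist_eq_norm] at hxy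
    have hmin := V.starProjection_minimal (K x)
    refine le_trans ?_ hxy.le
    change ‖K x - V.starProjection (K x)‖ ≤ _
    rw [hmin]
    exact ciInf_le ⟨0, by rintro _ ⟨w, rfl⟩; positivity⟩ (⟨y, Submodule.subset_span hy⟩ : V)

/-- The Fredholm property and the index are stable under compact perturbations. -/
theorem IsFredholmPair.add_isFiniteRankLimit [CompleteSpace H₁] [CompleteSpace H₂]
    {D K : H₁ →L[𝕜] H₂} (hD : IsFredholmPair D 0) (hK : IsFiniteRankLimit K) :
    IsFredholmPair (D + K) 0 ∧ index D 0 = index (D + K) 0 := by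
  obtain ⟨ε, hε, h⟩ := hD.exists_pos_forall_norm_sub_lt
  obtain ⟨F, hF, hKF⟩ := hK ε hε
  -- The small part `K - F` is added first; the remaining `F` changes nothing on its kernel, which
  -- has finite codimension.
  obtain ⟨h1, h2⟩ := h (D + (K - F)) (by simpa using hKF)
  obtain ⟨h3, h4⟩ := h1.congr_left (S' := D + K)
    ((almostLE_ker_iff (F : H₁ →ₗ[𝕜] H₂)).2 hF) (fun x hx => by
      have hx' : F x = 0 := hx
      simp [hx'])
  exact ⟨h3, h2.trans h4⟩

theorem eq_zero_of_mem_orthogonal_nullSpace (T : H₂ →L[𝕜] H₁) {x : H₂} (hx : x ∈ (nullSpace T)ᗮ)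
    (h : T x = 0) : x = 0 :=
  (Submodule.mem_bot 𝕜).1 ((nullSpace T).inf_orthogonal_eq_bot ▸
    (⟨h, hx⟩ : x ∈ nullSpace T ⊓ (nullSpace T)ᗮ))

theorem exists_eq_add_of_nullSpace [CompleteSpace H₂] (T : H₂ →L[𝕜] H₁) (x : H₂) :
    ∃ n ∈ nullSpace T, ∃ m ∈ (nullSpace T)ᗮ, x = n + m := by
  have : CompleteSpace (nullSpace T) := T.isClosed_ker.completeSpace_coe
  have hx : x ∈ nullSpace T ⊔ (nullSpace T)ᗮ := by
    rw [Submodule.sup_orthogonal_of_hasOrthogonalProjection]; trivial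
  obtain ⟨n, hn, m, hm, h⟩ := Submodule.mem_sup.1 hx
  exact ⟨n, hn, m, hm, h.symm⟩

theorem apply_comp_eq_zero {E F G : Type*} [NormedAddCommGroup E] [InnerProductSpace 𝕜 E]
    [NormedAddCommGroup F] [InnerProductSpace 𝕜 F] [NormedAddCommGroup G] [InnerProductSpace 𝕜 G]
    {A : F →L[𝕜] G} {B : E →L[𝕜] F} (h : A ∘L B = 0) (x : E) : A (B x) = 0 :=
  congrArg (fun L : E →L[𝕜] G => L x) h

theorem isFiniteRankLimit_sub_of_eqOn {S S' : H₁ →L[𝕜] H₂} {W : Submodule 𝕜 H₁}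
    (hW : AlmostLE ⊤ W) (h : ∀ x ∈ W, S x = S' x) : IsFiniteRankLimit (S - S') := by
  refine .of_finiteDimensional_range ((almostLE_ker_iff _).1 (hW.mono le_rfl fun x hx => ?_))
  change S x - S' x = 0
  rw [h x hx, sub_self]

/-- `R(T)` lies in `N(S)` up to finite dimension; apply `S`. -/
theorem IsFredholmPair.finiteDimensional_range_comp {S : H₁ →L[𝕜] H₂} {T : H₂ →L[𝕜] H₁}
    (h : IsFredholmPair S T) : FiniteDimensional 𝕜 (rangeSpace (S ∘L T)) := by
  have h2 := ((isFredholmPair_iff.1 h).1.2).map (S : H₁ →ₗ[𝕜] H₂)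
  rw [← almostLE_bot_iff]
  refine h2.mono ?_ ?_
  · rintro _ ⟨x, rfl⟩
    exact ⟨T x, ⟨x, rfl⟩, rfl⟩
  · rintro _ ⟨x, hx, rfl⟩
    exact hx

end FredholmPair

/-! ### Pairs with vanishing products and the operator `S + T†`. -/

namespace FredholmPair

open Submodule ContinuousLinearMap

variable {𝕜 H₁ H₂ : Type*} [RCLike 𝕜]
  [NormedAddCommGroup H₁] [InnerProductSpace 𝕜 H₁] [CompleteSpace H₁]
  [NormedAddCommGroup H₂] [InnerProductSpace 𝕜 H₂] [CompleteSpace H₂]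

/-- Restricted to `N(T)ᗮ`, `T` is an injective bounded map into the Hilbert space `C` with the same
range, and a finite dimensional, hence closed, algebraic complement forces that range to be closed.
-/
theorem isClosed_range_of_almostLE {T : H₂ →L[𝕜] H₁} {C : Submodule 𝕜 H₁}
    (hC : IsClosed (C : Set H₁)) (hTC : rangeSpace T ≤ C) (h : AlmostLE C (rangeSpace T)) :
    IsClosed (rangeSpace T : Set H₁) := by
  have : CompleteSpace C := hC.completeSpace_coe
  let M := (nullSpace T)ᗮ
  let f : M →L[𝕜] C := (T.codRestrict C fun x => hTC ⟨x, rfl⟩) ∘L M.subtypeL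
  have hmem : ∀ y : C, y ∈ LinearMap.range (f : M →ₗ[𝕜] C) ↔ (y : H₁) ∈ rangeSpace T := by
    intro y
    constructor
    · rintro ⟨x, rfl⟩
      exact ⟨x, rfl⟩
    · rintro ⟨x, hx⟩
      obtain ⟨n, hn, m, hm, rfl⟩ := exists_eq_add_of_nullSpace T x
      refine ⟨⟨m, hm⟩, Subtype.ext ?_⟩
      have hn' : T n = 0 := hn
      change T m = y
      rw [← hx]
      simp [hn']
  obtain ⟨V, hV⟩ := Submodule.exists_isCompl (LinearMap.range (f : M →ₗ[𝕜] C))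
  have hVfin : FiniteDimensional 𝕜 (V.map C.subtype) := by
    rw [← almostLE_bot_iff]
    have h1 : AlmostLE (V.map C.subtype) (rangeSpace T ⊓ V.map C.subtype) :=
      (h.mono (Submodule.map_subtype_le C V) le_rfl).inf (AlmostLE.of_le le_rfl)
    refine h1.mono le_rfl ?_
    rintro _ ⟨hx, ⟨x, hxV, rfl⟩⟩
    have hx0 : x ∈ LinearMap.range (f : M →ₗ[𝕜] C) ⊓ V := ⟨(hmem x).2 hx, hxV⟩
    rw [hV.inf_eq_bot, Submodule.mem_bot] at hx0
    simp [hx0]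
  have hVfin' : FiniteDimensional 𝕜 V :=
    Module.Finite.equiv (Submodule.equivMapOfInjective _ C.injective_subtype V).symm
  have hker : LinearMap.ker (f : M →ₗ[𝕜] C) = ⊥ := by
    rw [LinearMap.ker_eq_bot']
    intro x hx
    exact Subtype.ext (eq_zero_of_mem_orthogonal_nullSpace T x.2 (congrArg Subtype.val hx))
  have hcl := f.closed_complemented_range_of_isCompl_of_ker_eq_bot V hV
    V.closed_of_finiteDimensional hker
  have himage := hC.isClosedEmbedding_subtypeVal.isClosedMap _ hcl
  convert himage using 1
  ext y
  constructor
  · intro hy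
    exact ⟨⟨y, hTC hy⟩, (hmem _).2 hy, rfl⟩
  · rintro ⟨x, hx, rfl⟩
    exact (hmem x).1 hx

/-- Closed range gives a bounded `g` with `g ∘ T` the projection onto `N(T)ᗮ`; taking adjoints, `T†
(g† y) = y` for `y` in `N(T)ᗮ`. -/
theorem orthogonal_nullSpace_le_range_adjoint {T : H₂ →L[𝕜] H₁}
    (h : IsClosed (rangeSpace T : Set H₁)) : (nullSpace T)ᗮ ≤ rangeSpace (adjoint T) := by
  let M := (nullSpace T)ᗮ
  let f : M →L[𝕜] H₁ := T ∘L M.subtypeL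
  have hinj : Function.Injective f := by
    rw [injective_iff_map_eq_zero]
    intro x hx
    exact Subtype.ext (eq_zero_of_mem_orthogonal_nullSpace T x.2 hx)
  have hr : Set.range f = (rangeSpace T : Set H₁) := by
    ext y
    constructor
    · rintro ⟨x, rfl⟩
      exact ⟨x, rfl⟩
    · rintro ⟨x, rfl⟩
      obtain ⟨n, hn, m, hm, rfl⟩ := exists_eq_add_of_nullSpace T x
      have hn' : T n = 0 := hn
      exact ⟨⟨m, hm⟩, by simp [f, hn']⟩
  have hcl : IsClosed (Set.range f) := hr ▸ h
  let e := f.equivRange hinj hcl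
  have : CompleteSpace (LinearMap.range (f : M →ₗ[𝕜] H₁)) :=
    IsClosed.completeSpace_coe (hs := hcl)
  let g : H₁ →L[𝕜] M :=
    (e.symm : _ →L[𝕜] M) ∘L (LinearMap.range (f : M →ₗ[𝕜] H₁)).orthogonalProjectionOnto
  have hg : ∀ m : M, g (f m) = m := by
    intro m
    have h1 : (LinearMap.range (f : M →ₗ[𝕜] H₁)).orthogonalProjectionOnto (f m) = e m := by
      refine Eq.trans ?_
        (Submodule.orthogonalProjectionOnto_mem_subspace_eq_self (e m))
      rfl
    simp [g, h1]
  intro y hy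
  refine ⟨adjoint g ⟨y, hy⟩, ?_⟩
  refine ext_inner_right 𝕜 fun x => ?_
  obtain ⟨n, hn, m, hm, rfl⟩ := exists_eq_add_of_nullSpace T x
  have hn' : T n = 0 := hn
  have hTx : T (n + m) = f ⟨m, hm⟩ := by simp [f, hn']
  change inner 𝕜 (adjoint T _) _ = _
  rw [adjoint_inner_left, hTx, adjoint_inner_left, hg, inner_add_right,
    Submodule.inner_left_of_mem_orthogonal hn hy, zero_add]
  rfl

/-- `TS = 0` makes `S x` and `T† x` orthogonal, so their sum vanishes only if both do; and `N(T†) =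
R(T)ᗮ`. -/
theorem nullSpace_add_adjoint {S : H₁ →L[𝕜] H₂} {T : H₂ →L[𝕜] H₁} (hTS : T ∘L S = 0) :
    nullSpace (S + adjoint T) = nullSpace S ⊓ (rangeSpace T)ᗮ := by
  have hort : ∀ x, x ∈ (rangeSpace T)ᗮ ↔ adjoint T x = 0 := by
    intro x
    rw [Submodule.mem_orthogonal']
    constructor
    · intro h
      refine ext_inner_right 𝕜 fun y => ?_
      rw [adjoint_inner_left, inner_zero_left]
      exact h _ ⟨y, rfl⟩
    · rintro h _ ⟨y, rfl⟩
      change inner 𝕜 x (T y) = 0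
      rw [← adjoint_inner_left, h, inner_zero_left]
  ext x
  rw [Submodule.mem_inf, hort]
  constructor
  · intro hx
    have hx' : S x + adjoint T x = 0 := hx
    have h0 : inner 𝕜 (S x) (adjoint T x) = 0 := by
      rw [adjoint_inner_right, apply_comp_eq_zero hTS, inner_zero_left]
    have hS : S x = 0 := by
      rw [eq_neg_of_add_eq_zero_right hx', inner_neg_right, neg_eq_zero] at h0
      exact inner_self_eq_zero.1 h0
    refine ⟨hS, ?_⟩
    simpa [hS] using hx'
  · rintro ⟨h1, h2⟩
    have h1' : S x = 0 := h1
    change S x + adjoint T x = 0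
    rw [h1', h2, add_zero]

/-- The index of a Fredholm complex of length two is the index of `S + T†`. -/
theorem IsFredholmPair.add_adjoint {S : H₁ →L[𝕜] H₂} {T : H₂ →L[𝕜] H₁} (h : IsFredholmPair S T)
    (hST : S ∘L T = 0) (hTS : T ∘L S = 0) :
    IsFredholmPair (S + adjoint T) 0 ∧ index S T = index (S + adjoint T) 0 := by
  obtain ⟨⟨h1, -⟩, h3, -⟩ := isFredholmPair_iff.1 h
  have hRT : rangeSpace T ≤ nullSpace S := by
    rintro _ ⟨x, rfl⟩
    exact apply_comp_eq_zero hST x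
  have hRS : rangeSpace S ≤ nullSpace T := by
    rintro _ ⟨x, rfl⟩
    exact apply_comp_eq_zero hTS x
  have hcl : IsClosed (rangeSpace T : Set H₁) := isClosed_range_of_almostLE S.isClosed_ker hRT h1
  have hcomplete : CompleteSpace (rangeSpace T) := hcl.completeSpace_coe
  have hcomplete' : CompleteSpace (nullSpace T) := T.isClosed_ker.completeSpace_coe
  have hsup : rangeSpace T ⊔ (rangeSpace T)ᗮ = ⊤ :=
    Submodule.sup_orthogonal_of_hasOrthogonalProjection
  -- Hodge decomposition: `N(S)` is the direct sum of `N(S + T†)` and `R(T)`, so the kernel of `S +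
  -- T†` represents `N(S) / R(T)`.
  have hN := nullSpace_add_adjoint hTS
  have hNsup : nullSpace (S + adjoint T) ⊔ rangeSpace T = nullSpace S := by
    rw [hN, sup_comm, inf_comm, ← sup_inf_assoc_of_le _ hRT, hsup, top_inf_eq]
  have hNdisj : nullSpace (S + adjoint T) ⊓ rangeSpace T = ⊥ := by
    rw [hN, eq_bot_iff, ← (rangeSpace T).inf_orthogonal_eq_bot]
    exact fun x hx => ⟨hx.2, hx.1.2⟩
  have hR1 : rangeSpace S ≤ rangeSpace (S + adjoint T) := by
    rintro _ ⟨x, rfl⟩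
    obtain ⟨u, hu, v, hv, rfl⟩ := Submodule.mem_sup.1 (hsup.ge (mem_top (x := x)))
    refine ⟨v, ?_⟩
    have hu' : S u = 0 := hRT hu
    have hv' : adjoint T v = 0 := by
      refine ext_inner_right 𝕜 fun y => ?_
      rw [adjoint_inner_left, inner_zero_left]
      exact Submodule.inner_left_of_mem_orthogonal (⟨y, rfl⟩ : T y ∈ rangeSpace T) hv
    simp [hu', hv']
  have hadj : rangeSpace (adjoint T) ≤ (nullSpace T)ᗮ := by
    rintro _ ⟨x, rfl⟩
    rw [Submodule.mem_orthogonal']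
    intro y hy
    have hy' : T y = 0 := hy
    change inner 𝕜 (adjoint T x) y = 0
    rw [adjoint_inner_left, hy', inner_zero_right]
  have hR2 : rangeSpace (S + adjoint T) ⊓ nullSpace T = rangeSpace S := by
    refine le_antisymm ?_ (le_inf hR1 hRS)
    rintro _ ⟨⟨x, rfl⟩, hx⟩
    have hSx : S x ∈ nullSpace T := hRS ⟨x, rfl⟩
    have h0 : adjoint T x ∈ nullSpace T := by
      have := (nullSpace T).sub_mem hx hSx
      simpa using this
    have h0' : adjoint T x = 0 := eq_zero_of_mem_orthogonal_nullSpace T (hadj ⟨x, rfl⟩) h0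
    exact ⟨x, by simp [h0']⟩
  have hR3 : (nullSpace T)ᗮ ≤ rangeSpace (S + adjoint T) := by
    refine (orthogonal_nullSpace_le_range_adjoint hcl).trans ?_
    rintro _ ⟨x, rfl⟩
    have hx : (S + adjoint T) x - S x ∈ rangeSpace (S + adjoint T) :=
      Submodule.sub_mem _ ⟨x, rfl⟩ (hR1 ⟨x, rfl⟩)
    simpa using hx
  -- As `R(S + T†)` meets `N(T)` in `R(S)`, this identifies the cokernel of `S + T†` with `N(T) /
  -- R(S)`.
  have htop : nullSpace T ⊔ rangeSpace (S + adjoint T) = ⊤ := by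
    rw [eq_top_iff, ← (nullSpace T).sup_orthogonal_of_hasOrthogonalProjection]
    exact sup_le_sup_left hR3 _
  have ea : relCodim (nullSpace S) (rangeSpace T)
      = Module.finrank 𝕜 (nullSpace (S + adjoint T)) := by
    rw [← hNsup, relCodim_sup_right, ← relCodim_bot]
    exact relCodim_congr (by rw [hNdisj, inf_bot_eq])
  have ec : relCodim ⊤ (rangeSpace (S + adjoint T)) = relCodim (nullSpace T) (rangeSpace S) := by
    rw [← htop, relCodim_sup_right]
    refine relCodim_congr ?_
    rw [inf_comm, hR2, inf_eq_right.2 hRS]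
  refine ⟨isFredholmPair_zero_iff.2 ⟨?_, ?_⟩, ?_⟩
  · rw [← almostLE_bot_iff, ← hNdisj]
    exact (AlmostLE.of_le le_rfl).inf (h1.mono (hN ▸ inf_le_left) le_rfl)
  · obtain ⟨V, hV, hle⟩ := almostLE_iff_exists.1 h3
    refine almostLE_iff_exists.2 ⟨V, hV, ?_⟩
    rw [← htop]
    exact sup_le (hle.trans (sup_le_sup_right hR1 V)) le_sup_left
  · rw [index_zero, index_eq_relDim, relDim, relDim, ea, ec, relCodim_of_le hRT,
      relCodim_of_le hRS]
    push_cast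
    ring

/-- The projection onto `N(S)` fixes `R(T)` and kills `R(S†)`, so it turns `x = T y + S† y + v` in
`N(S)` into `x = T y + P v`. -/
theorem almostLE_nullSpace_range {S : H₁ →L[𝕜] H₂} {T : H₂ →L[𝕜] H₁} (hST : S ∘L T = 0)
    (h : AlmostLE ⊤ (rangeSpace (T + adjoint S))) : AlmostLE (nullSpace S) (rangeSpace T) := by
  have : CompleteSpace (nullSpace S) := S.isClosed_ker.completeSpace_coe
  let P := (nullSpace S).starProjection
  obtain ⟨V, hV, hle⟩ := almostLE_iff_exists.1 h
  refine almostLE_iff_exists.2 ⟨V.map (P : H₁ →ₗ[𝕜] H₁), inferInstance, ?_⟩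
  intro x hx
  obtain ⟨_, ⟨y, rfl⟩, v, hv, hxv⟩ := Submodule.mem_sup.1 (hle (mem_top (x := x)))
  have hPx : P x = x := Submodule.starProjection_eq_self_iff.2 hx
  have hPT : P (T y) = T y :=
    Submodule.starProjection_eq_self_iff.2 (apply_comp_eq_zero hST y)
  have hPS : P (adjoint S y) = 0 := by
    refine (Submodule.starProjection_apply_eq_zero_iff (K := nullSpace S)).2 ?_
    rw [Submodule.mem_orthogonal']
    intro z hz
    have hz' : S z = 0 := hz
    rw [adjoint_inner_left, hz', inner_zero_right]
  refine Submodule.mem_sup.2 ⟨T y, ⟨y, rfl⟩, P v, ⟨v, hv, rfl⟩, ?_⟩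
  rw [← hPx, ← hxv, map_add]
  congr 1
  change _ = P (T y + adjoint S y)
  rw [map_add, hPT, hPS, add_zero]

/-! ### Reduction to vanishing products. -/

/-- If `TS` and `ST` have finite rank, then finite rank changes of `S` and `T` make both products
vanish. -/
theorem exists_comp_eq_zero {S : H₁ →L[𝕜] H₂} {T : H₂ →L[𝕜] H₁}
    (hTS : FiniteDimensional 𝕜 (rangeSpace (T ∘L S)))
    (hST : FiniteDimensional 𝕜 (rangeSpace (S ∘L T))) :
    ∃ (S' : H₁ →L[𝕜] H₂) (T' : H₂ →L[𝕜] H₁) (W : Submodule 𝕜 H₁) (W' : Submodule 𝕜 H₂),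
      AlmostLE ⊤ W ∧ AlmostLE ⊤ W' ∧ (∀ x ∈ W, S x = S' x) ∧ (∀ y ∈ W', T y = T' y) ∧
      S' ∘L T' = 0 ∧ T' ∘L S' = 0 := by
  let W := nullSpace (T ∘L S)
  have hW : AlmostLE ⊤ W := (almostLE_ker_iff _).2 hTS
  have : CompleteSpace W := (T ∘L S).isClosed_ker.completeSpace_coe
  let S' := S ∘L W.starProjection
  have hSS' : ∀ x ∈ W, S x = S' x := fun x hx => by
    change S x = S (W.starProjection x)
    rw [Submodule.starProjection_eq_self_iff.2 hx]
  have hTS' : ∀ x, T (S' x) = 0 := fun x => W.starProjection_apply_mem x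
  -- Since `T S' = 0`, `W'` contains `R(S')`; precomposing `T` with the projection onto `W'` thus
  -- kills `S' T` without spoiling `T S' = 0`.
  let W' := nullSpace (S' ∘L T)
  have hW' : AlmostLE ⊤ W' := by
    have h1 : AlmostLE ⊤ (nullSpace (S ∘L T)) := (almostLE_ker_iff _).2 hST
    refine (h1.inf (hW.comap (T : H₂ →ₗ[𝕜] H₁))).mono le_rfl ?_
    rintro y ⟨hy, hyW⟩
    change S' (T y) = 0
    rw [← hSS' (T y) hyW]
    exact hy
  have : CompleteSpace W' := (S' ∘L T).isClosed_ker.completeSpace_coe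
  refine ⟨S', T ∘L W'.starProjection, W, W', hW, hW', hSS', fun y hy => ?_, ?_, ?_⟩
  · change T y = T (W'.starProjection y)
    rw [Submodule.starProjection_eq_self_iff.2 hy]
  · ext y
    exact W'.starProjection_apply_mem y
  · ext x
    have hx : S' x ∈ W' := by
      change S' (T (S' x)) = 0
      rw [hTS', map_zero]
    change T (W'.starProjection (S' x)) = 0
    rw [Submodule.starProjection_eq_self_iff.2 hx, hTS']

/-- Compact perturbations of pairs with vanishing products preserve the Fredholm property and the
index. -/
theorem IsFredholmPair.of_comp_eq_zero {S S₁ : H₁ →L[𝕜] H₂} {T T₁ : H₂ →L[𝕜] H₁}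
    (h : IsFredholmPair S T) (hST : S ∘L T = 0) (hTS : T ∘L S = 0)
    (hST₁ : S₁ ∘L T₁ = 0) (hTS₁ : T₁ ∘L S₁ = 0)
    (hS : IsFiniteRankLimit (S₁ - S)) (hT : IsFiniteRankLimit (T₁ - T)) :
    IsFredholmPair S₁ T₁ ∧ index S T = index S₁ T₁ := by
  obtain ⟨hD, hind⟩ := h.add_adjoint hST hTS
  -- `S + T†` controls only `N(T₁) / R(S₁)` below; the finiteness of `N(S₁) / R(T₁)` comes from `T +
  -- S†`.
  obtain ⟨hD', -⟩ := h.symm.add_adjoint hTS hST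
  obtain ⟨hD₁, hind₁⟩ := hD.add_isFiniteRankLimit (hS.add hT.adjoint)
  obtain ⟨hD₁', -⟩ := hD'.add_isFiniteRankLimit (hT.add hS.adjoint)
  have e : S + adjoint T + (S₁ - S + adjoint (T₁ - T)) = S₁ + adjoint T₁ := by
    rw [map_sub]; abel
  have e' : T + adjoint S + (T₁ - T + adjoint (S₁ - S)) = T₁ + adjoint S₁ := by
    rw [map_sub]; abel
  rw [e] at hD₁ hind₁
  rw [e'] at hD₁'
  have hpair : IsFredholmPair S₁ T₁ := isFredholmPair_iff.2
    ⟨⟨almostLE_nullSpace_range hST₁ (isFredholmPair_zero_iff.1 hD₁').2, AlmostLE.of_le (by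
        rintro _ ⟨x, rfl⟩
        exact apply_comp_eq_zero hST₁ x)⟩,
      almostLE_nullSpace_range hTS₁ (isFredholmPair_zero_iff.1 hD₁).2, AlmostLE.of_le (by
        rintro _ ⟨x, rfl⟩
        exact apply_comp_eq_zero hTS₁ x)⟩
  exact ⟨hpair, hind.trans (hind₁.trans (hpair.add_adjoint hST₁ hTS₁).2.symm)⟩

end FredholmPair

theorem theorem5p2 {𝕜 H₁ H₂ : Type*} [RCLike 𝕜]
    [NormedAddCommGroup H₁] [InnerProductSpace 𝕜 H₁] [CompleteSpace H₁]
    [NormedAddCommGroup H₂] [InnerProductSpace 𝕜 H₂] [CompleteSpace H₂]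
    (S : H₁ →L[𝕜] H₂) (T : H₂ →L[𝕜] H₁) (hST : FredholmPair.IsFredholmPair S T)
    (K : H₁ →L[𝕜] H₂) (K' : H₂ →L[𝕜] H₁)
    (hK : IsCompactOperator K) (hK' : IsCompactOperator K')
    (S₁ : H₁ →L[𝕜] H₂) (T₁ : H₂ →L[𝕜] H₁) (hS₁ : S₁ = S + K) (hT₁ : T₁ = T + K')
    (hTS : FiniteDimensional 𝕜 (FredholmPair.rangeSpace (T₁ ∘L S₁)))
    (hST₁ : FiniteDimensional 𝕜 (FredholmPair.rangeSpace (S₁ ∘L T₁))) :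
    FredholmPair.IsFredholmPair S₁ T₁ ∧
      FredholmPair.index S T = FredholmPair.index S₁ T₁ := by
  obtain ⟨A, B, W, W', hW, hW', hA, hB, hAB, hBA⟩ := FredholmPair.exists_comp_eq_zero
    hST.symm.finiteDimensional_range_comp hST.finiteDimensional_range_comp
  obtain ⟨A₁, B₁, W₁, W₁', hW₁, hW₁', hA₁, hB₁, hAB₁, hBA₁⟩ :=
    FredholmPair.exists_comp_eq_zero hTS hST₁
  have hA' : ∀ x ∈ W₁, A₁ x = S₁ x := fun x hx => (hA₁ x hx).symm
  have hB' : ∀ x ∈ W₁', B₁ x = T₁ x := fun x hx => (hB₁ x hx).symm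
  obtain ⟨p1, i1⟩ := hST.congr_left hW hA
  obtain ⟨p2, i2⟩ := p1.congr_right hW' hB
  have hSdiff : FredholmPair.IsFiniteRankLimit (A₁ - A) := by
    -- The outer summands have finite rank, vanishing on `W₁` and `W`.
    have e : A₁ - A = (A₁ - S₁) + K + (S - A) := by rw [hS₁]; abel
    rw [e]
    exact ((FredholmPair.isFiniteRankLimit_sub_of_eqOn hW₁ hA').add
      (FredholmPair.isFiniteRankLimit_of_isCompactOperator hK)).add
      (FredholmPair.isFiniteRankLimit_sub_of_eqOn hW hA)
  have hTdiff : FredholmPair.IsFiniteRankLimit (B₁ - B) := by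
    have e : B₁ - B = (B₁ - T₁) + K' + (T - B) := by rw [hT₁]; abel
    rw [e]
    exact ((FredholmPair.isFiniteRankLimit_sub_of_eqOn hW₁' hB').add
      (FredholmPair.isFiniteRankLimit_of_isCompactOperator hK')).add
      (FredholmPair.isFiniteRankLimit_sub_of_eqOn hW' hB)
  obtain ⟨p3, i3⟩ := p2.of_comp_eq_zero hAB hBA hAB₁ hBA₁ hSdiff hTdiff
  obtain ⟨p4, i4⟩ := p3.congr_left hW₁ hA'
  obtain ⟨p5, i5⟩ := p4.congr_right hW₁' hB'
  exact ⟨p5, i1.trans (i2.trans (i3.trans (i4.trans i5)))⟩
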